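/- Let $\mathbb G$ be a compact Lie group equipped with a bi-invariant Riemannian metric, let $\mathcal L$ be its Laplace–Beltrami operator, and let $\mathrm dx$ be the normalized Haar measure on $\mathbb G$. All functions are real-valued. Let $H^1_{\mathcal L}(\mathbb G)=\{f\in L^2(\mathbb G):(-\mathcal L)^{1/2}f\in L^2(\mathbb G)\}$, with norm $\|f\|_{L^2}+\|(-\mathcal L)^{1/2}f\|_{L^2}$, where $(-\mathcal L)^{1/2}$ is defined by the spectral decomposition of $-\mathcal L$. Let $p,q>1$, $b>0$ and $b^2\ge 4m^2>0$. For $\varepsilon>0$ consider the weakly coupled system $$\begin{cases}\partial_t^2u-\mathcal Lu+b\,\partial_tu+m^2u=|v|^p,& x\in\mathbb G,\ t>0,\\ \partial_t^2v-\mathcal Lv=|u|^q,& x\in\mathbb G,\ t>0,\\ (u,\partial_tu)(0,x)=\varepsilon(u_0,u_1)(x),\quad (v,\partial_tv)(0,x)=\varepsilon(v_0,v_1)(x),& x\in\mathbb G.\end{cases}$$ For $T>0$, a pair $(u,v)$ is an *energy solution on $[0,T)$* if $$u\in C([0,T),H^1_{\mathcal L}(\mathbb G))\cap C^1([0,T),L^2(\mathbb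 G))\cap L^q_{\mathrm{loc}}([0,T)\times\mathbb G),\quad v\in C([0,T),H^1_{\mathcal L}(\mathbb G))\cap C^1([0,T),L^2(\mathbb G))\cap L^p_{\mathrm{loc}}([0,T)\times\mathbb G),$$ and, for all $\psi,\varphi\in C_0^\infty([0,T)\times\mathbb G)$ and all $t\in(0,T)$, $$\begin{aligned}\int_0^t\!\!\int_{\mathbb G}|v|^p\psi\,\mathrm dx\,\mathrm ds={}&\int_{\mathbb G}\big(\partial_tu(t,x)\psi(t,x)-u(t,x)\partial_s\psi(t,x)+b\,u(t,x)\psi(t,x)\big)\mathrm dx\\&-\varepsilon\int_{\mathbb G}\big(u_1(x)\psi(0,x)-u_0(x)\partial_s\psi(0,x)+b\,u_0(x)\psi(0,x)\big)\mathrm dx\\&+\int_0^t\!\!\int_{\mathbb G}u\,\big(\partial_s^2\psi-\mathcal L\psi-b\,\partial_s\psi+m^2\psi\big)\mathrm dx\,\mathrm ds,\\ \int_0^t\!\!\int_{\mathbb G}|u|^q\varphi\,\mathrm dx\,\mathrm ds={}&\int_{\mathbb G}\big(\partial_tv(t,x)\varphi(t,x)-v(t,x)\partial_s\varphi(t,x)\big)\mathrm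 dx-\varepsilon\int_{\mathbb G}\big(v_1(x)\varphi(0,x)-v_0(x)\partial_s\varphi(0,x)\big)\mathrm dx\\&+\int_0^t\!\!\int_{\mathbb G}v\,\big(\partial_s^2\varphi-\mathcal L\varphi\big)\mathrm dx\,\mathrm ds.\end{aligned}$$ The *lifespan* of $(u,v)$ is $T(\varepsilon)=\sup\{\tau>0:(u,v)\text{ is an energy solution on }[0,\tau)\}\in(0,\infty]$; the solution *blows up in finite time* if $T(\varepsilon)<\infty$. **Theorem.** Let $u_0,v_0\in H^1_{\mathcal L}(\mathbb G)$ and $u_1,v_1\in L^2(\mathbb G)$ be non-negative (almost everywhere), and assume that each of the pairs $(u_0,u_1)$ and $(v_0,v_1)$ has at least one component which is not almost everywhere zero. Then there are constants $\varepsilon_0>0$ and $C>0$, depending only on $\mathbb G$, its metric, $u_0,u_1,v_0,v_1,b,m^2,p,q$ (in particular, not on $\varepsilon$ or on the solution), such that for every $\varepsilon\in(0,\varepsilon_0]$ every energy solution $(u,v)$ (on some $[0,T)$ with $T>0$) blows up in finite time, and its lifespan satisfies $$T(\varepsilon)\le\begin{cases}C\,\varepsilon^{-\frac{pq-1}{pq+1}}&\text{if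 }v_1\ne0,\\[2pt] C\,\varepsilon^{-\frac{pq-1}{2}}&\text{if }v_1=0.\end{cases}$$ -/

import Mathlib

open MeasureTheory Set
open scoped Manifold ContDiff ENNReal

noncomputable section

namespace CompactLieWave

variable {n : ℕ} {G : Type*} [TopologicalSpace G] [ChartedSpace (EuclideanSpace ℝ (Fin n)) G]

/-- Smooth Riemannian metrics on the `n`-dimensional smooth manifold `G`. -/
abbrev RiemMetric (n : ℕ) (G : Type*) [TopologicalSpace G]
    [ChartedSpace (EuclideanSpace ℝ (Fin n)) G] [IsManifold (𝓡 n) 1 G] : Type _ :=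
  Bundle.ContMDiffRiemannianMetric (𝓡 n) ∞ (EuclideanSpace ℝ (Fin n))
    (fun x : G => TangentSpace (𝓡 n) x)

/-- The partial derivative `∂_i h (y)` of a function on `ℝⁿ`. -/
def partialDeriv (i : Fin n) (h : EuclideanSpace ℝ (Fin n) → ℝ)
    (y : EuclideanSpace ℝ (Fin n)) : ℝ :=
  fderiv ℝ h y (EuclideanSpace.single i 1)

/-- The coordinate vector field `∂_i` of the chart around `x`, at the point of `G` with
coordinates `y`. -/
def coordVec (x : G) (y : EuclideanSpace ℝ (Fin n)) (i : Fin n) :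
    TangentSpace (𝓡 n) ((extChartAt (𝓡 n) x).symm y) :=
  mfderiv 𝓘(ℝ, EuclideanSpace ℝ (Fin n)) (𝓡 n) (extChartAt (𝓡 n) x).symm y
    (EuclideanSpace.single i 1 : EuclideanSpace ℝ (Fin n))

/-- The coefficient matrix `(g_ij)` of the metric in the chart around `x`, at the coordinates
`y`. -/
def coordMetric [IsManifold (𝓡 n) 1 G] (g : RiemMetric n G) (x : G)
    (y : EuclideanSpace ℝ (Fin n)) : Matrix (Fin n) (Fin n) ℝ :=
  Matrix.of fun i j =>
    g.inner ((extChartAt (𝓡 n) x).symm y) (coordVec x y i) (coordVec x y j)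

/-- The Laplace-Beltrami operator `(det g)^(-1/2) ∑_i ∂_i ((det g)^(1/2) ∑_j g^ij ∂_j f)`,
computed at `x` in the preferred chart around `x`. -/
def laplaceBeltrami [IsManifold (𝓡 n) 1 G] (g : RiemMetric n G) (f : G → ℝ) (x : G) : ℝ :=
  (√(coordMetric g x (extChartAt (𝓡 n) x x)).det)⁻¹ *
    ∑ i, partialDeriv i
      (fun y => √(coordMetric g x y).det *
        ∑ j, (coordMetric g x y)⁻¹ i j *
          partialDeriv j (fun z => f ((extChartAt (𝓡 n) x).symm z)) y)
      (extChartAt (𝓡 n) x x)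

/-- A Riemannian metric on a group is bi-invariant if all left and all right translations are
isometries. -/
def IsBiInvariant [Group G] [IsManifold (𝓡 n) 1 G] (g : RiemMetric n G) : Prop :=
  ∀ (a x : G) (w z : TangentSpace (𝓡 n) x),
    g.inner (a * x) (mfderiv (𝓡 n) (𝓡 n) (fun y : G => a * y) x w)
        (mfderiv (𝓡 n) (𝓡 n) (fun y : G => a * y) x z) = g.inner x w z ∧
    g.inner (x * a) (mfderiv (𝓡 n) (𝓡 n) (fun y : G => y * a) x w)
        (mfderiv (𝓡 n) (𝓡 n) (fun y : G => y * a) x z) = g.inner x w z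

variable [MeasurableSpace G]

/-- `h = (-𝓛)^(1/2) f` for `f, h ∈ L²(G)`, in the sense of the spectral decomposition of `-𝓛`:
the coefficient of `h` along every (smooth) eigenfunction `e` of `-𝓛`, with eigenvalue `l ≥ 0`,
is `√l` times the coefficient of `f`. As the eigenfunctions span a dense subspace of `L²(G)`,
`f` determines `h`. -/
def IsSqrtNegLaplacian [IsManifold (𝓡 n) 1 G] (g : RiemMetric n G) (μ : Measure G)
    (f h : Lp ℝ 2 μ) : Prop :=
  ∀ (l : ℝ) (e : G → ℝ), 0 ≤ l → ContMDiff (𝓡 n) 𝓘(ℝ, ℝ) ∞ e →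
    (∀ x, -laplaceBeltrami g e x = l * e x) →
    ∫ x, h x * e x ∂μ = √l * ∫ x, f x * e x ∂μ

/-- Membership in the Sobolev space `H¹(G) = {f ∈ L²(G) : (-𝓛)^(1/2) f ∈ L²(G)}`. -/
def MemH1 [IsManifold (𝓡 n) 1 G] (g : RiemMetric n G) (μ : Measure G) (f : Lp ℝ 2 μ) : Prop :=
  ∃ h : Lp ℝ 2 μ, IsSqrtNegLaplacian g μ f h

/-- `u ∈ C([0,T), H¹(G))` for the norm `‖f‖_{L²} + ‖(-𝓛)^(1/2) f‖_{L²}`. -/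
def ContinuousInH1 [IsManifold (𝓡 n) 1 G] (g : RiemMetric n G) (μ : Measure G)
    (T : ℝ) (u : ℝ → Lp ℝ 2 μ) : Prop :=
  ContinuousOn u (Ico 0 T) ∧
    ∃ w : ℝ → Lp ℝ 2 μ, ContinuousOn w (Ico 0 T) ∧
      ∀ t ∈ Ico 0 T, IsSqrtNegLaplacian g μ (u t) (w t)

/-- `u ∈ L^r_loc([0,T) × G)`, written as `u ∈ L^r((0,t); L^r(G))` for all `t < T` (every compact
subset of `[0,T) × G` lies in some `[0,t] × G`, as `G` is compact). -/
def MemLrLoc {G : Type*} [MeasurableSpace G] (μ : Measure G) (T r : ℝ)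
    (u : ℝ → Lp ℝ 2 μ) : Prop :=
  ∀ t ∈ Ioo 0 T,
    (∀ᵐ s ∂(volume.restrict (Ioc 0 t)), Integrable (fun x => |u s x| ^ r) μ) ∧
    IntegrableOn (fun s => ∫ x, |u s x| ^ r ∂μ) (Ioc 0 t)

/-- The test functions `C₀^∞([0,T) × G)`: restrictions to `[0,T) × G` of smooth functions on
`ℝ × G` which vanish for all times `s ≥ T'`, for some `T' < T` (for `G` compact this says that
the support in `[0,T) × G` is compact). -/
def IsTestFunction (n : ℕ) {G : Type*} [TopologicalSpace G]
    [ChartedSpace (EuclideanSpace ℝ (Fin n)) G] (T : ℝ) (ψ : ℝ → G → ℝ) : Prop :=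
  ContMDiff (𝓘(ℝ, ℝ).prod (𝓡 n)) 𝓘(ℝ, ℝ) ∞ (fun z : ℝ × G => ψ z.1 z.2) ∧
    ∃ T' < T, ∀ s, T' ≤ s → ∀ x, ψ s x = 0

/-- `∂_s ψ (s, x)`. -/
def dt {G : Type*} (ψ : ℝ → G → ℝ) (s : ℝ) (x : G) : ℝ := deriv (fun r => ψ r x) s

/-- The velocity `∂_t u (t) ∈ L²(G)` of a curve on `[0,T)` (one-sided at `t = 0`). -/
def vel {G : Type*} [MeasurableSpace G] {μ : Measure G} (T : ℝ) (u : ℝ → Lp ℝ 2 μ) (t : ℝ) :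
    Lp ℝ 2 μ :=
  derivWithin u (Ico 0 T) t

/-- `(u, v)` is an energy solution on `[0,T)` of the weakly coupled system
`u_tt - 𝓛u + b u_t + m² u = |v|^p`, `v_tt - 𝓛v = |u|^q` with data
`(u, u_t)(0) = ε (u₀, u₁)`, `(v, v_t)(0) = ε (v₀, v₁)`. -/
structure IsEnergySolution [IsManifold (𝓡 n) 1 G] (g : RiemMetric n G) (μ : Measure G)
    (b m p q ε : ℝ) (u₀ u₁ v₀ v₁ : Lp ℝ 2 μ) (T : ℝ) (u v : ℝ → Lp ℝ 2 μ) : Prop where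
  u_H1 : ContinuousInH1 g μ T u
  u_C1 : ContDiffOn ℝ 1 u (Ico 0 T)
  u_Lq : MemLrLoc μ T q u
  v_H1 : ContinuousInH1 g μ T v
  v_C1 : ContDiffOn ℝ 1 v (Ico 0 T)
  v_Lp : MemLrLoc μ T p v
  eq_u : ∀ ψ : ℝ → G → ℝ, IsTestFunction n T ψ → ∀ t ∈ Ioo 0 T,
    ∫ s in (0 : ℝ)..t, ∫ x, |v s x| ^ p * ψ s x ∂μ =
      ∫ x, vel T u t x * ψ t x ∂μ - ∫ x, u t x * dt ψ t x ∂μ + b * ∫ x, u t x * ψ t x ∂μ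
      - ε * ∫ x, u₁ x * ψ 0 x ∂μ + ε * ∫ x, u₀ x * dt ψ 0 x ∂μ
      - ε * b * ∫ x, u₀ x * ψ 0 x ∂μ
      + ∫ s in (0 : ℝ)..t, ∫ x, u s x *
          (dt (dt ψ) s x - laplaceBeltrami g (ψ s) x - b * dt ψ s x + m ^ 2 * ψ s x) ∂μ
  eq_v : ∀ φ : ℝ → G → ℝ, IsTestFunction n T φ → ∀ t ∈ Ioo 0 T,
    ∫ s in (0 : ℝ)..t, ∫ x, |u s x| ^ q * φ s x ∂μ =
      ∫ x, vel T v t x * φ t x ∂μ - ∫ x, v t x * dt φ t x ∂μ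
      - ε * ∫ x, v₁ x * φ 0 x ∂μ + ε * ∫ x, v₀ x * dt φ 0 x ∂μ
      + ∫ s in (0 : ℝ)..t, ∫ x, v s x *
          (dt (dt φ) s x - laplaceBeltrami g (φ s) x) ∂μ

/-- The lifespan of `(u, v)`: the supremum in `[0,∞]` of all `τ > 0` such that `(u, v)` is an
energy solution on `[0,τ)`. -/
def lifespan [IsManifold (𝓡 n) 1 G] (g : RiemMetric n G) (μ : Measure G)
    (b m p q ε : ℝ) (u₀ u₁ v₀ v₁ : Lp ℝ 2 μ) (u v : ℝ → Lp ℝ 2 μ) : ℝ≥0∞ :=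
  ⨆ (τ : ℝ) (_ : 0 < τ ∧ IsEnergySolution g μ b m p q ε u₀ u₁ v₀ v₁ τ u v), ENNReal.ofReal τ

end CompactLieWave

end

/-!
The proof averages the system over space. Tested with functions of time alone, the Laplacian drops
out, and the means `U` and `V` of `u` and `v` solve `U'' + b U' + m² U = ∫ |v|^p` and
`V'' = ∫ |u|^q`. As `4m² ≤ b²`, the damped oscillator has a non-negative fundamental solution, and
Duhamel's formula together with Jensen's inequality bounds `U` and `V` below by iterated integrals
of `|V|^p` and `|U|^q`. If `V` has reached the level `A`, then `U` is at least of order `A^p δ²`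
after a delay `δ ≤ 1`, so `V` gains at least a multiple of `A^(pq) δ^(2q) σ²` within a further time
`σ`. Since `pq > 1`, geometrically decreasing delays and growth times of total length at most
`C₁ + C₂ A^(-(pq-1)/2)` suffice to double `V` infinitely often. The theorem follows from
`V t ≥ ε (∫ v₀ + t ∫ v₁)` by choosing the starting time and the level `A` optimally.
-/

namespace CompactLieWave

/-! ### Blow-up from superlinear gains -/

section Iteration

variable {c r α β A x y S T t : ℝ} {V : ℝ → ℝ}

/-- The growth property that drives the blow-up iteration on `(0, T)`: a level `A` reached by `V`
at time `t` produces a gain proportional to `A ^ r`, once a delay `δ ≤ 1` and a further time `σ`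
have passed. -/
def HasDelayedGain (c r α β T : ℝ) (V : ℝ → ℝ) : Prop :=
  ∀ ⦃t A δ σ : ℝ⦄, 0 < t → 0 < A → A ≤ V t → 0 < δ → δ ≤ 1 → 0 < σ → t + δ + σ < T →
    A + c * A ^ r * δ ^ α * σ ^ β ≤ V (t + δ + σ)

/-- The `k`-th time of the blow-up iteration started at `t`: the `j`-th step has delay `x ^ j` and
growth time `S * y ^ j`. -/
noncomputable def iterationTime (t x y S : ℝ) (k : ℕ) : ℝ :=
  t + ∑ j ∈ Finset.range k, (x ^ j + S * y ^ j)

theorem iterationTime_succ (k : ℕ) :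
    iterationTime t x y S (k + 1) = iterationTime t x y S k + x ^ k + S * y ^ k := by
  rw [iterationTime, Finset.sum_range_succ, iterationTime]
  ring

theorem le_iterationTime (hx : 0 ≤ x) (hy : 0 ≤ y) (hS : 0 ≤ S) (k : ℕ) :
    t ≤ iterationTime t x y S k :=
  le_add_of_nonneg_right (Finset.sum_nonneg fun j _ => by positivity)

theorem geom_sum_le_inv_one_sub (hx : x ∈ Ioo 0 1) (k : ℕ) :
    ∑ j ∈ Finset.range k, x ^ j ≤ (1 - x)⁻¹ := by
  rw [Finset.range_eq_Ico]
  exact (geom_sum_Ico_le_of_lt_one hx.1.le hx.2).trans_eq (by rw [pow_zero, one_div])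

theorem iterationTime_le (hx : x ∈ Ioo 0 1) (hy : y ∈ Ioo 0 1) (hS : 0 ≤ S) (k : ℕ) :
    iterationTime t x y S k ≤ t + (1 - x)⁻¹ + S * (1 - y)⁻¹ := by
  rw [iterationTime, Finset.sum_add_distrib, ← Finset.mul_sum, add_assoc]
  gcongr
  · exact geom_sum_le_inv_one_sub hx k
  · exact geom_sum_le_inv_one_sub hy k

theorem gain_at_doubled_level (hA : 0 < A) (hx : 0 < x) (hy : 0 < y) (hS : 0 < S)
    (hxy : 2 ^ (r - 1) * x ^ α * y ^ β = 1) (hSA : c * A ^ (r - 1) * S ^ β = 1) (k : ℕ) :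
    c * (2 ^ k * A) ^ r * (x ^ k) ^ α * (S * y ^ k) ^ β = 2 ^ k * A := by
  have hlevel : (2 ^ k * A) ^ r = (2 ^ (r - 1)) ^ k * A ^ (r - 1) * (2 ^ k * A) := by
    rw [Real.rpow_pow_comm zero_le_two, ← Real.mul_rpow (by positivity) hA.le,
      ← Real.rpow_add_one (by positivity), sub_add_cancel]
  rw [hlevel, Real.mul_rpow hS.le (by positivity), ← Real.rpow_pow_comm hx.le,
    ← Real.rpow_pow_comm hy.le]
  calc c * ((2 ^ (r - 1)) ^ k * A ^ (r - 1) * (2 ^ k * A)) * (x ^ α) ^ k * (S ^ β * (y ^ β) ^ k)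
      = (c * A ^ (r - 1) * S ^ β) * (2 ^ (r - 1) * x ^ α * y ^ β) ^ k * (2 ^ k * A) := by ring
    _ = 2 ^ k * A := by rw [hSA, hxy, one_pow, one_mul, one_mul]

theorem HasDelayedGain.two_pow_mul_le (h : HasDelayedGain c r α β T V) (ht : 0 < t) (hA : 0 < A)
    (hAV : A ≤ V t) (hx : x ∈ Ioo 0 1) (hy : y ∈ Ioo 0 1) (hS : 0 < S)
    (hxy : 2 ^ (r - 1) * x ^ α * y ^ β = 1) (hSA : c * A ^ (r - 1) * S ^ β = 1)
    (hT : t + (1 - x)⁻¹ + S * (1 - y)⁻¹ < T) (k : ℕ) :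
    2 ^ k * A ≤ V (iterationTime t x y S k) := by
  induction k with
  | zero => simpa [iterationTime] using hAV
  | succ k ih =>
    have hgain := h (ht.trans_le (le_iterationTime hx.1.le hy.1.le hS.le k)) (by positivity) ih
      (pow_pos hx.1 k) (pow_le_one₀ hx.1.le hx.2.le) (mul_pos hS (pow_pos hy.1 k))
      (iterationTime_succ k ▸ (iterationTime_le hx hy hS.le (k + 1)).trans_lt hT)
    rw [gain_at_doubled_level hA hx.1 hy.1 hS hxy hSA, ← iterationTime_succ] at hgain
    calc 2 ^ (k + 1) * A = 2 ^ k * A + 2 ^ k * A := by ring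
      _ ≤ _ := hgain

theorem HasDelayedGain.le_add_of_ratios (h : HasDelayedGain c r α β T V)
    (hV : MonotoneOn V (Ioo 0 T)) (ht : 0 < t) (hA : 0 < A) (hAV : t < T → A ≤ V t)
    (hx : x ∈ Ioo 0 1) (hy : y ∈ Ioo 0 1) (hS : 0 < S)
    (hxy : 2 ^ (r - 1) * x ^ α * y ^ β = 1) (hSA : c * A ^ (r - 1) * S ^ β = 1) :
    T ≤ t + (1 - x)⁻¹ + S * (1 - y)⁻¹ := by
  by_contra! hT
  set tLim := t + (1 - x)⁻¹ + S * (1 - y)⁻¹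
  have ht_iter (k : ℕ) : t ≤ iterationTime t x y S k := le_iterationTime hx.1.le hy.1.le hS.le k
  have h_iter_lim (k : ℕ) : iterationTime t x y S k ≤ tLim := iterationTime_le hx hy hS.le k
  have htLim : t ≤ tLim := (ht_iter 0).trans (h_iter_lim 0)
  have hbound (k : ℕ) : 2 ^ k * A ≤ V tLim :=
    (h.two_pow_mul_le ht hA (hAV (htLim.trans_lt hT)) hx hy hS hxy hSA hT k).trans <|
      hV ⟨ht.trans_le (ht_iter k), (h_iter_lim k).trans_lt hT⟩ ⟨ht.trans_le htLim, hT⟩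
        (h_iter_lim k)
  obtain ⟨k, hk⟩ := pow_unbounded_of_one_lt (V tLim / A) one_lt_two
  exact (hbound k).not_gt ((div_lt_iff₀ hA).1 hk)

theorem two_rpow_neg_mem_Ioo {a : ℝ} (ha : 0 < a) : (2 : ℝ) ^ (-a) ∈ Ioo 0 1 :=
  ⟨by positivity, Real.rpow_lt_one_of_one_lt_of_neg one_lt_two (neg_neg_of_pos ha)⟩

theorem exists_forall_le_of_hasDelayedGain (hc : 0 < c) (hr : 1 < r) (hα : 0 < α) (hβ : 0 < β) :
    ∃ C₁ C₂ : ℝ, 0 < C₁ ∧ 0 < C₂ ∧ ∀ {T : ℝ} {V : ℝ → ℝ}, HasDelayedGain c r α β T V →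
      MonotoneOn V (Ioo 0 T) → ∀ t A : ℝ, 0 < t → 0 < A → (t < T → A ≤ V t) →
        T ≤ t + C₁ + C₂ * A ^ (-((r - 1) / β)) := by
  have hr₁ : 0 < r - 1 := sub_pos.2 hr
  -- The gain `2 ^ (r - 1)` per doubling is shared evenly between the delays and the growth times.
  obtain ⟨x, hx_def⟩ : ∃ x : ℝ, x = 2 ^ (-((r - 1) / (2 * α))) := ⟨_, rfl⟩
  obtain ⟨y, hy_def⟩ : ∃ y : ℝ, y = 2 ^ (-((r - 1) / (2 * β))) := ⟨_, rfl⟩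
  have hx : x ∈ Ioo 0 1 := hx_def ▸ two_rpow_neg_mem_Ioo (div_pos hr₁ (by positivity))
  have hy : y ∈ Ioo 0 1 := hy_def ▸ two_rpow_neg_mem_Ioo (div_pos hr₁ (by positivity))
  have hxy : 2 ^ (r - 1) * x ^ α * y ^ β = 1 := by
    rw [hx_def, hy_def, ← Real.rpow_mul zero_le_two, ← Real.rpow_mul zero_le_two,
      ← Real.rpow_add two_pos, ← Real.rpow_add two_pos, ← Real.rpow_zero 2]
    congr 1
    field_simp
    ring
  refine ⟨(1 - x)⁻¹, c ^ (-(1 / β)) * (1 - y)⁻¹, inv_pos.2 (sub_pos.2 hx.2),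
    mul_pos (by positivity) (inv_pos.2 (sub_pos.2 hy.2)), fun {T V} h hV t A ht hA hAV => ?_⟩
  have hSA : c * A ^ (r - 1) * (c ^ (-(1 / β)) * A ^ (-((r - 1) / β))) ^ β = 1 := by
    rw [Real.mul_rpow (by positivity) (by positivity), ← Real.rpow_mul hc.le, ← Real.rpow_mul hA.le,
      neg_mul, neg_mul, div_mul_cancel₀ _ hβ.ne', div_mul_cancel₀ _ hβ.ne', Real.rpow_neg hc.le,
      Real.rpow_neg hA.le, Real.rpow_one]
    field_simp
  refine (h.le_add_of_ratios hV ht hA hAV hx hy (by positivity) hxy hSA).trans_eq ?_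
  ring

end Iteration

/-! ### The damped oscillator -/

section DampedOscillator

variable {b m y₀ y₁ t T τ : ℝ} {f y y' a : ℝ → ℝ}

/-- The solution of `y'' + b y' + m² y = 0` with data `y 0 = 0`, `y' 0 = 1`, for `4m² ≤ b²`. Writing
`sinh (d τ) / d` as `∫ cosh (d r) dr` includes the critically damped case `d = 0`. -/
noncomputable def dampedSinh (b m τ : ℝ) : ℝ :=
  Real.exp (-(b / 2) * τ) * ∫ r in (0 : ℝ)..τ, Real.cosh (√(b ^ 2 / 4 - m ^ 2) * r)

/-- The solution of `y'' + b y' + m² y = 0` with data `y 0 = 1`, `y' 0 = -b / 2`, for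
`4m² ≤ b²`. -/
noncomputable def dampedCosh (b m τ : ℝ) : ℝ :=
  Real.exp (-(b / 2) * τ) * Real.cosh (√(b ^ 2 / 4 - m ^ 2) * τ)

@[simp] theorem dampedSinh_zero_right : dampedSinh b m 0 = 0 := by simp [dampedSinh]

@[simp] theorem dampedCosh_zero_right : dampedCosh b m 0 = 1 := by simp [dampedCosh]

@[simp] theorem dampedSinh_zero_zero : dampedSinh 0 0 τ = τ := by simp [dampedSinh]

@[simp] theorem dampedCosh_zero_zero : dampedCosh 0 0 τ = 1 := by simp [dampedCosh]

theorem dampedCosh_nonneg : 0 ≤ dampedCosh b m τ :=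
  mul_nonneg (Real.exp_nonneg _) (Real.cosh_pos _).le

theorem self_le_integral_cosh (d : ℝ) (hτ : 0 ≤ τ) : τ ≤ ∫ r in (0 : ℝ)..τ, Real.cosh (d * r) := by
  have h := intervalIntegral.integral_mono_on hτ
    (continuous_const (y := (1 : ℝ)).intervalIntegrable (μ := volume) 0 τ)
    ((by fun_prop : Continuous fun r => Real.cosh (d * r)).intervalIntegrable (μ := volume) 0 τ)
    fun r _ => Real.one_le_cosh (d * r)
  simpa using h

theorem dampedSinh_nonneg (hτ : 0 ≤ τ) : 0 ≤ dampedSinh b m τ :=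
  mul_nonneg (Real.exp_nonneg _) (hτ.trans (self_le_integral_cosh _ hτ))

theorem exp_mul_le_dampedSinh (hb : 0 ≤ b) (hτ : τ ∈ Icc 0 1) :
    Real.exp (-(b / 2)) * τ ≤ dampedSinh b m τ := by
  refine mul_le_mul (Real.exp_le_exp.2 ?_) (self_le_integral_cosh _ hτ.1) hτ.1 (Real.exp_nonneg _)
  nlinarith [hτ.2]

theorem hasDerivAt_exp_const_mul (k τ : ℝ) :
    HasDerivAt (fun s => Real.exp (k * s)) (Real.exp (k * τ) * k) τ := by
  simpa using ((hasDerivAt_id τ).const_mul k).exp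

theorem hasDerivAt_cosh_const_mul (d τ : ℝ) :
    HasDerivAt (fun s => Real.cosh (d * s)) (Real.sinh (d * τ) * d) τ := by
  simpa using ((hasDerivAt_id τ).const_mul d).cosh

theorem hasDerivAt_dampedSinh (b m τ : ℝ) :
    HasDerivAt (dampedSinh b m) (dampedCosh b m τ - b / 2 * dampedSinh b m τ) τ := by
  have hcosh : Continuous fun r => Real.cosh (√(b ^ 2 / 4 - m ^ 2) * r) := by fun_prop
  refine ((hasDerivAt_exp_const_mul (-(b / 2)) τ).mul
    (hcosh.integral_hasStrictDerivAt 0 τ).hasDerivAt).congr_deriv ?_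
  rw [dampedCosh, dampedSinh]
  ring

theorem sinh_mul_eq_sq_mul_integral_cosh (d τ : ℝ) :
    Real.sinh (d * τ) * d = d ^ 2 * ∫ r in (0 : ℝ)..τ, Real.cosh (d * r) := by
  have h : ∫ r in (0 : ℝ)..τ, Real.cosh (d * r) * d = Real.sinh (d * τ) := by
    rw [intervalIntegral.integral_eq_sub_of_hasDerivAt (f := fun s => Real.sinh (d * s))
      (fun s _ => by simpa using ((hasDerivAt_id s).const_mul d).sinh)
      (Continuous.intervalIntegrable (by fun_prop) _ _)]
    simp
  rw [← h, intervalIntegral.integral_mul_const]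
  ring

theorem hasDerivAt_dampedCosh (hbm : 4 * m ^ 2 ≤ b ^ 2) (τ : ℝ) :
    HasDerivAt (dampedCosh b m)
      (-(b / 2) * dampedCosh b m τ + (b ^ 2 / 4 - m ^ 2) * dampedSinh b m τ) τ := by
  refine ((hasDerivAt_exp_const_mul (-(b / 2)) τ).mul
    (hasDerivAt_cosh_const_mul _ τ)).congr_deriv ?_
  rw [sinh_mul_eq_sq_mul_integral_cosh, Real.sq_sqrt (by linarith), dampedCosh, dampedSinh]
  ring

theorem contDiff_dampedSinh : ContDiff ℝ ∞ (dampedSinh b m) := by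
  have hcosh : ContDiff ℝ ∞ fun r => Real.cosh (√(b ^ 2 / 4 - m ^ 2) * r) :=
    Real.contDiff_cosh.comp (contDiff_const.mul contDiff_id)
  have hderiv (τ : ℝ) := (hcosh.continuous.integral_hasStrictDerivAt 0 τ).hasDerivAt
  refine (Real.contDiff_exp.comp (contDiff_const.mul contDiff_id)).mul
    (contDiff_infty_iff_deriv.2 ⟨fun τ => (hderiv τ).differentiableAt, ?_⟩)
  rwa [funext fun τ => (hderiv τ).deriv]

/-- `y` solves `y'' + b y' + m² y = f` on `[0, T)` with data `y 0 = y₀`, `y' 0 = y₁`, weakly: the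
equation is tested with smooth functions of time on every `[0, t]`, where `y'` is the velocity. -/
def IsWeakOscillator (b m y₀ y₁ T : ℝ) (f y y' : ℝ → ℝ) : Prop :=
  ∀ a : ℝ → ℝ, ContDiff ℝ ∞ a → (∃ T' < T, ∀ s, T' ≤ s → a s = 0) → ∀ t ∈ Ioo 0 T,
    ∫ s in (0 : ℝ)..t, f s * a s =
      y' t * a t - y t * deriv a t + b * (y t * a t)
      - y₁ * a 0 + y₀ * deriv a 0 - b * (y₀ * a 0)
      + ∫ s in (0 : ℝ)..t, y s * (deriv (deriv a) s - b * deriv a s + m ^ 2 * a s)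

theorem exists_contDiff_cutoff (ht : t < T) (ha : ContDiff ℝ ∞ a) :
    ∃ h : ℝ → ℝ, ContDiff ℝ ∞ h ∧ (∃ T' < T, ∀ s, T' ≤ s → h s = 0) ∧ ∀ s ≤ t, h =ᶠ[nhds s] a := by
  obtain ⟨t₁, ht₁, h1T⟩ := exists_between ht
  obtain ⟨t₂, ht₂, h2T⟩ := exists_between h1T
  refine ⟨fun s => a s * Real.smoothTransition ((t₂ - s) / (t₂ - t₁)),
    ha.mul (Real.smoothTransition.contDiff.comp ((contDiff_const.sub contDiff_id).div_const _)),
    ⟨t₂, h2T, fun s hs => ?_⟩, fun s hs => ?_⟩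
  · have hneg : (t₂ - s) / (t₂ - t₁) ≤ 0 :=
      div_nonpos_of_nonpos_of_nonneg (sub_nonpos.2 hs) (sub_pos.2 ht₂).le
    simp only [Real.smoothTransition.zero_of_nonpos hneg, mul_zero]
  · filter_upwards [Iio_mem_nhds (hs.trans_lt ht₁)] with r hr
    have hone : 1 ≤ (t₂ - r) / (t₂ - t₁) := by
      rw [one_le_div (sub_pos.2 ht₂)]
      exact sub_le_sub_left (mem_Iio.1 hr).le t₂
    simp only [Real.smoothTransition.one_of_one_le hone, mul_one]

theorem IsWeakOscillator.integral_eq (h : IsWeakOscillator b m y₀ y₁ T f y y') (ht : t ∈ Ioo 0 T)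
    (ha : ContDiff ℝ ∞ a) :
    ∫ s in (0 : ℝ)..t, f s * a s =
      y' t * a t - y t * deriv a t + b * (y t * a t)
      - y₁ * a 0 + y₀ * deriv a 0 - b * (y₀ * a 0)
      + ∫ s in (0 : ℝ)..t, y s * (deriv (deriv a) s - b * deriv a s + m ^ 2 * a s) := by
  obtain ⟨k, hk, hkT, hka⟩ := exists_contDiff_cutoff ht.2 ha
  have h0 : ∀ s ≤ t, k s = a s := fun s hs => (hka s hs).self_of_nhds
  have h1 : ∀ s ≤ t, deriv k s = deriv a s := fun s hs => (hka s hs).deriv_eq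
  have h2 : ∀ s ≤ t, deriv (deriv k) s = deriv (deriv a) s := fun s hs =>
    (hka s hs).deriv.deriv_eq
  have hle : ∀ s ∈ uIcc 0 t, s ≤ t := fun s hs => (uIcc_of_le ht.1.le ▸ hs).2
  have hf : ∫ s in (0 : ℝ)..t, f s * k s = ∫ s in (0 : ℝ)..t, f s * a s :=
    intervalIntegral.integral_congr fun s hs => by simp only [h0 s (hle s hs)]
  have hy : ∫ s in (0 : ℝ)..t, y s * (deriv (deriv k) s - b * deriv k s + m ^ 2 * k s) =
      ∫ s in (0 : ℝ)..t, y s * (deriv (deriv a) s - b * deriv a s + m ^ 2 * a s) :=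
    intervalIntegral.integral_congr fun s hs => by
      simp only [h0 s (hle s hs), h1 s (hle s hs), h2 s (hle s hs)]
  have key := h k hk hkT t ht
  rwa [hf, hy, h0 t le_rfl, h1 t le_rfl, h0 0 ht.1.le, h1 0 ht.1.le] at key

theorem IsWeakOscillator.duhamel (h : IsWeakOscillator b m y₀ y₁ T f y y')
    (hbm : 4 * m ^ 2 ≤ b ^ 2) (ht : t ∈ Ioo 0 T) :
    y t = y₀ * (dampedCosh b m t + b / 2 * dampedSinh b m t) + y₁ * dampedSinh b m t
      + ∫ s in (0 : ℝ)..t, dampedSinh b m (t - s) * f s := by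
  have hderiv : deriv (fun s => dampedSinh b m (t - s)) =
      fun s => -(dampedCosh b m (t - s) - b / 2 * dampedSinh b m (t - s)) :=
    funext fun s => ((hasDerivAt_dampedSinh b m (t - s)).comp_const_sub t s).deriv
  have hderiv₂ (s : ℝ) : deriv (deriv fun s => dampedSinh b m (t - s)) s =
      -b * dampedCosh b m (t - s) + (b ^ 2 / 2 - m ^ 2) * dampedSinh b m (t - s) := by
    rw [hderiv]
    refine HasDerivAt.deriv (((((hasDerivAt_dampedCosh hbm (t - s)).sub
      ((hasDerivAt_dampedSinh b m (t - s)).const_mul (b / 2))).comp_const_sub t s).neg).congr_deriv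
        ?_)
    ring
  have hadjoint (s : ℝ) : deriv (deriv fun s => dampedSinh b m (t - s)) s
      - b * deriv (fun s => dampedSinh b m (t - s)) s + m ^ 2 * dampedSinh b m (t - s) = 0 := by
    rw [hderiv₂, hderiv]
    ring
  have hsmooth : ContDiff ℝ ∞ fun s => dampedSinh b m (t - s) :=
    contDiff_dampedSinh.comp (contDiff_const.sub contDiff_id)
  have key := h.integral_eq ht hsmooth
  simp only [hadjoint, mul_zero, intervalIntegral.integral_zero] at key
  simp only [hderiv, sub_self, sub_zero, dampedSinh_zero_right, dampedCosh_zero_right] at key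
  have hswap : ∫ s in (0 : ℝ)..t, dampedSinh b m (t - s) * f s =
      ∫ s in (0 : ℝ)..t, f s * dampedSinh b m (t - s) := by
    simp only [mul_comm]
  rw [hswap, key]
  ring

end DampedOscillator

/-! ### Averages of solutions -/

theorem mul_sq_le_integral_kernel_mul {K f : ℝ → ℝ} {a t δ e M : ℝ} (hδ : 0 ≤ δ)
    (hat : a ≤ t - δ) (hM : 0 ≤ M) (hK : Continuous K) (hK0 : ∀ τ, 0 ≤ τ → 0 ≤ K τ)
    (hKe : ∀ τ ∈ Icc 0 δ, e * τ ≤ K τ) (hf0 : ∀ s, 0 ≤ f s) (hf : IntervalIntegrable f volume a t)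
    (hMf : ∀ᵐ s ∂volume.restrict (Ioc (t - δ) t), M ≤ f s) :
    e * M * (δ ^ 2 / 2) ≤ ∫ s in a..t, K (t - s) * f s := by
  have htδ : t - δ ≤ t := sub_le_self t hδ
  have hKf : IntervalIntegrable (fun s => K (t - s) * f s) volume a t :=
    hf.continuousOn_mul (hK.comp (continuous_const.sub continuous_id)).continuousOn
  calc e * M * (δ ^ 2 / 2) = ∫ s in (t - δ)..t, e * M * (t - s) := by
        rw [intervalIntegral.integral_const_mul,
          intervalIntegral.integral_comp_sub_left (fun s => s), integral_id]
        ring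
    _ ≤ ∫ s in (t - δ)..t, K (t - s) * f s := by
        refine intervalIntegral.integral_mono_ae_restrict htδ
          (Continuous.intervalIntegrable (by fun_prop) _ _)
          (hKf.mono_set (uIcc_subset_uIcc_right (mem_uIcc_of_le hat htδ))) ?_
        rw [← restrict_Ioc_eq_restrict_Icc]
        filter_upwards [hMf, ae_restrict_mem measurableSet_Ioc] with s hMs hs
        have hτ : 0 ≤ t - s := sub_nonneg.2 hs.2
        calc e * M * (t - s) = e * (t - s) * M := by ring
          _ ≤ K (t - s) * M := by gcongr; exact hKe _ ⟨hτ, by linarith [hs.1]⟩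
          _ ≤ K (t - s) * f s := mul_le_mul_of_nonneg_left hMs (hK0 _ hτ)
    _ ≤ ∫ s in a..t, K (t - s) * f s := by
        refine intervalIntegral.integral_mono_interval hat htδ le_rfl ?_ hKf
        filter_upwards [ae_restrict_mem measurableSet_Ioc] with s hs
        exact mul_nonneg (hK0 _ (sub_nonneg.2 hs.2)) (hf0 s)

/-- The ordinary differential (in)equalities satisfied by the spatial means `U` and `V` of a
solution of the coupled system: `V'' = F` with data `V 0 = c₀`, `V' 0 = c₁`, and `U` lies above the
solution of `U'' + b U' + m² U = P` with zero data. The sources `F` and `P` stand for the means of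
`|u|^q` and `|v|^p`, which dominate `|U|^q` and `|V|^p` by Jensen's inequality. -/
structure MeanSystem (p q b m c₀ c₁ T : ℝ) (F P U V : ℝ → ℝ) : Prop where
  c₁_nonneg : 0 ≤ c₁
  F_nonneg : ∀ s, 0 ≤ F s
  P_nonneg : ∀ s, 0 ≤ P s
  F_integrable : ∀ t ∈ Ioo 0 T, IntervalIntegrable F volume 0 t
  P_integrable : ∀ t ∈ Ioo 0 T, IntervalIntegrable P volume 0 t
  V_eq : ∀ t ∈ Ioo 0 T, V t = c₀ + c₁ * t + ∫ s in (0 : ℝ)..t, (t - s) * F s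
  le_U : ∀ t ∈ Ioo 0 T, ∫ s in (0 : ℝ)..t, dampedSinh b m (t - s) * P s ≤ U t
  le_F : ∀ t ∈ Ioo 0 T, ∀ᵐ s ∂volume.restrict (Ioc 0 t), |U s| ^ q ≤ F s
  le_P : ∀ t ∈ Ioo 0 T, ∀ᵐ s ∂volume.restrict (Ioc 0 t), |V s| ^ p ≤ P s

namespace MeanSystem

variable {p q b m c₀ c₁ T t₀ t δ A : ℝ} {F P U V : ℝ → ℝ}

theorem integral_nonneg (h : MeanSystem p q b m c₀ c₁ T F P U V) (ht : t₀ ≤ t) :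
    0 ≤ ∫ s in t₀..t, (t - s) * F s :=
  intervalIntegral.integral_nonneg ht fun s hs => mul_nonneg (sub_nonneg.2 hs.2) (h.F_nonneg s)

theorem add_integral_le (h : MeanSystem p q b m c₀ c₁ T F P U V) (h0 : 0 < t₀) (ht₀ : t₀ ≤ t)
    (ht : t < T) : V t₀ + ∫ s in t₀..t, (t - s) * F s ≤ V t := by
  have ht₀T : t₀ ∈ Ioo 0 T := ⟨h0, ht₀.trans_lt ht⟩
  have htT : t ∈ Ioo 0 T := ⟨h0.trans_le ht₀, ht⟩
  have hF₀ := h.F_integrable t₀ ht₀T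
  have hF₁ : IntervalIntegrable F volume t₀ t := hF₀.symm.trans (h.F_integrable t htT)
  have hkernel (r : ℝ) (I : Set ℝ) : ContinuousOn (fun s => r - s) I := by fun_prop
  rw [h.V_eq t htT, h.V_eq t₀ ht₀T, ← intervalIntegral.integral_add_adjacent_intervals
    (hF₀.continuousOn_mul (hkernel t _)) (hF₁.continuousOn_mul (hkernel t _)), ← add_assoc]
  gcongr ?_ + ?_ + _
  · gcongr
    exact h.c₁_nonneg
  · refine intervalIntegral.integral_mono_on h0.le (hF₀.continuousOn_mul (hkernel t₀ _))
      (hF₀.continuousOn_mul (hkernel t _)) fun s _ => ?_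
    gcongr
    exact h.F_nonneg s

theorem monotoneOn (h : MeanSystem p q b m c₀ c₁ T F P U V) : MonotoneOn V (Ioo 0 T) :=
  fun _ hr _ hs hrs =>
    (le_add_of_nonneg_right (h.integral_nonneg hrs)).trans (h.add_integral_le hr.1 hrs hs.2)

theorem linear_le (h : MeanSystem p q b m c₀ c₁ T F P U V) (ht : t ∈ Ioo 0 T) :
    c₀ + c₁ * t ≤ V t := by
  rw [h.V_eq t ht]
  exact le_add_of_nonneg_right (h.integral_nonneg ht.1.le)

theorem delayed_le_U (h : MeanSystem p q b m c₀ c₁ T F P U V) (hb : 0 ≤ b) (hp : 0 ≤ p)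
    (h0 : 0 < t₀) (hA : 0 ≤ A) (hVA : A ≤ V t₀) (hδ : δ ∈ Icc 0 1) (ht : t₀ + δ ≤ t)
    (htT : t < T) : Real.exp (-(b / 2)) * A ^ p * (δ ^ 2 / 2) ≤ U t := by
  have ht₀ : t₀ ≤ t - δ := le_sub_right_of_add_le ht
  have htI : t ∈ Ioo 0 T := ⟨(add_pos_of_pos_of_nonneg h0 hδ.1).trans_le ht, htT⟩
  refine (mul_sq_le_integral_kernel_mul hδ.1 (h0.le.trans ht₀) (Real.rpow_nonneg hA p)
    contDiff_dampedSinh.continuous (fun τ hτ => dampedSinh_nonneg hτ)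
    (fun τ hτ => exp_mul_le_dampedSinh hb (Icc_subset_Icc_right hδ.2 hτ)) h.P_nonneg
    (h.P_integrable t htI) ?_).trans (h.le_U t htI)
  filter_upwards [ae_restrict_of_ae_restrict_of_subset (Ioc_subset_Ioc_left (h0.le.trans ht₀))
    (h.le_P t htI), ae_restrict_mem measurableSet_Ioc] with s hPs hs
  have ht₀s : t₀ ≤ s := ht₀.trans hs.1.le
  have hVs : A ≤ V s := hVA.trans <|
    h.monotoneOn ⟨h0, ht₀s.trans_lt (hs.2.trans_lt htT)⟩
      ⟨h0.trans_le ht₀s, hs.2.trans_lt htT⟩ ht₀s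
  exact (Real.rpow_le_rpow hA (hVs.trans (le_abs_self _)) hp).trans hPs

theorem hasDelayedGain (h : MeanSystem p q b m c₀ c₁ T F P U V) (hb : 0 ≤ b) (hp : 0 ≤ p)
    (hq : 0 ≤ q) :
    HasDelayedGain ((Real.exp (-(b / 2)) / 2) ^ q / 2) (p * q) (2 * q) 2 T V := by
  intro t₀ A δ σ h0 hA hVA hδ hδ1 hσ hT
  have ht₀ : t₀ ≤ t₀ + δ := le_add_of_nonneg_right hδ.le
  have ht₀σ : t₀ ≤ t₀ + δ + σ := ht₀.trans (le_add_of_nonneg_right hσ.le)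
  have hσt : t₀ + δ + σ - σ = t₀ + δ := add_sub_cancel_right _ _
  have htI : t₀ + δ + σ ∈ Ioo 0 T := ⟨h0.trans_le ht₀σ, hT⟩
  have hFM : ∀ᵐ s ∂volume.restrict (Ioc (t₀ + δ + σ - σ) (t₀ + δ + σ)),
      (Real.exp (-(b / 2)) * A ^ p * (δ ^ 2 / 2)) ^ q ≤ F s := by
    rw [hσt]
    filter_upwards [ae_restrict_of_ae_restrict_of_subset
      (Ioc_subset_Ioc_left (h0.le.trans ht₀)) (h.le_F _ htI), ae_restrict_mem measurableSet_Ioc]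
      with s hFs hs
    exact (Real.rpow_le_rpow (by positivity) ((h.delayed_le_U hb hp h0 hA.le hVA ⟨hδ.le, hδ1⟩
      hs.1.le (hs.2.trans_lt hT)).trans (le_abs_self _)) hq).trans hFs
  have hgain := mul_sq_le_integral_kernel_mul hσ.le (ht₀.trans hσt.ge) (by positivity) continuous_id
    (fun _ hτ => hτ) (fun τ _ => (one_mul τ).le) h.F_nonneg
    ((h.F_integrable t₀ ⟨h0, ht₀σ.trans_lt hT⟩).symm.trans (h.F_integrable _ htI)) hFM
  have hM : (Real.exp (-(b / 2)) * A ^ p * (δ ^ 2 / 2)) ^ q =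
      (Real.exp (-(b / 2)) / 2) ^ q * A ^ (p * q) * δ ^ (2 * q) := by
    rw [Real.rpow_mul hA.le, Real.rpow_mul hδ.le, Real.rpow_two,
      ← Real.mul_rpow (by positivity) (by positivity),
      ← Real.mul_rpow (by positivity) (by positivity)]
    ring_nf
  calc A + (Real.exp (-(b / 2)) / 2) ^ q / 2 * A ^ (p * q) * δ ^ (2 * q) * σ ^ (2 : ℝ)
      = A + 1 * (Real.exp (-(b / 2)) * A ^ p * (δ ^ 2 / 2)) ^ q * (σ ^ 2 / 2) := by
        rw [hM, Real.rpow_two]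
        ring
    _ ≤ V t₀ + ∫ s in t₀..(t₀ + δ + σ), (t₀ + δ + σ - s) * F s := add_le_add hVA hgain
    _ ≤ V (t₀ + δ + σ) := h.add_integral_le h0 ht₀σ hT

end MeanSystem

section Integrals

variable {Ω : Type*} [MeasurableSpace Ω] {μ : Measure Ω}

theorem abs_integral_rpow_le [IsProbabilityMeasure μ] {r : ℝ} (hr : 1 ≤ r) {f : Ω → ℝ}
    (hf : Integrable f μ) (hfr : Integrable (fun x => |f x| ^ r) μ) :
    |∫ x, f x ∂μ| ^ r ≤ ∫ x, |f x| ^ r ∂μ := by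
  have hr0 : 0 ≤ r := zero_le_one.trans hr
  calc |∫ x, f x ∂μ| ^ r ≤ (∫ x, |f x| ∂μ) ^ r :=
        Real.rpow_le_rpow (abs_nonneg _) abs_integral_le_integral_abs hr0
    _ ≤ ∫ x, |f x| ^ r ∂μ := (convexOn_rpow hr).map_integral_le
        (continuousOn_id.rpow_const fun _ _ => Or.inr hr0) isClosed_Ici
        (Filter.Eventually.of_forall fun x => abs_nonneg (f x)) hf.abs hfr

theorem MemLrLoc.abs_integral_rpow_le [IsProbabilityMeasure μ] {T r t : ℝ} {u : ℝ → Lp ℝ 2 μ}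
    (hu : MemLrLoc μ T r u) (hr : 1 ≤ r) (ht : t ∈ Ioo 0 T) :
    ∀ᵐ s ∂volume.restrict (Ioc 0 t), |∫ x, u s x ∂μ| ^ r ≤ ∫ x, |u s x| ^ r ∂μ := by
  filter_upwards [(hu t ht).1] with s hs
  exact CompactLieWave.abs_integral_rpow_le hr ((Lp.memLp (u s)).integrable one_le_two) hs

theorem MemLrLoc.intervalIntegrable {T r t : ℝ} {u : ℝ → Lp ℝ 2 μ} (hu : MemLrLoc μ T r u)
    (ht : t ∈ Ioo 0 T) : IntervalIntegrable (fun s => ∫ x, |u s x| ^ r ∂μ) volume 0 t :=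
  (intervalIntegrable_iff_integrableOn_Ioc_of_le ht.1.le).2 (hu t ht).2

theorem integral_Lp_nonneg {p : ℝ≥0∞} {f : Lp ℝ p μ} (hf : 0 ≤ f) : 0 ≤ ∫ x, f x ∂μ :=
  integral_nonneg_of_ae ((Lp.coeFn_nonneg f).2 hf)

theorem integral_Lp_pos [IsFiniteMeasure μ] {p : ℝ≥0∞} {f : Lp ℝ p μ} (hp : 1 ≤ p) (hf : 0 ≤ f)
    (hf0 : f ≠ 0) : 0 < ∫ x, f x ∂μ := by
  refine (integral_Lp_nonneg hf).lt_of_ne fun h => hf0 (Lp.eq_zero_iff_ae_eq_zero.2 ?_)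
  exact (integral_eq_zero_iff_of_nonneg_ae ((Lp.coeFn_nonneg f).2 hf)
    ((Lp.memLp f).integrable hp)).1 h.symm

end Integrals

section Averages

variable {n : ℕ} {M : Type*} [TopologicalSpace M] [ChartedSpace (EuclideanSpace ℝ (Fin n)) M]

theorem laplaceBeltrami_const [IsManifold (𝓡 n) 1 M] (g : RiemMetric n M) (c : ℝ) (x : M) :
    laplaceBeltrami g (fun _ => c) x = 0 := by
  simp [laplaceBeltrami, partialDeriv]

theorem isTestFunction_of_contDiff {T : ℝ} {a : ℝ → ℝ} (ha : ContDiff ℝ ∞ a)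
    (haT : ∃ T' < T, ∀ s, T' ≤ s → a s = 0) : IsTestFunction n T fun s (_ : M) => a s := by
  obtain ⟨T', hT', ha0⟩ := haT
  exact ⟨ha.contMDiff.comp contMDiff_fst, T', hT', fun s hs _ => ha0 s hs⟩

variable [MeasurableSpace M] [IsManifold (𝓡 n) 1 M] {μ : Measure M} {g : RiemMetric n M}
  {b m p q ε T B : ℝ} {u₀ u₁ v₀ v₁ : Lp ℝ 2 μ} {u v : ℝ → Lp ℝ 2 μ}

theorem IsEnergySolution.isWeakOscillator_mean_u
    (h : IsEnergySolution g μ b m p q ε u₀ u₁ v₀ v₁ T u v) :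
    IsWeakOscillator b m (ε * ∫ x, u₀ x ∂μ) (ε * ∫ x, u₁ x ∂μ) T
      (fun s => ∫ x, |v s x| ^ p ∂μ) (fun s => ∫ x, u s x ∂μ) (fun s => ∫ x, vel T u s x ∂μ) := by
  intro a ha haT t ht
  have key := h.eq_u _ (isTestFunction_of_contDiff ha haT) t ht
  simp only [dt, laplaceBeltrami_const, integral_mul_const, sub_zero] at key
  linear_combination key

theorem IsEnergySolution.isWeakOscillator_mean_v
    (h : IsEnergySolution g μ b m p q ε u₀ u₁ v₀ v₁ T u v) :
    IsWeakOscillator 0 0 (ε * ∫ x, v₀ x ∂μ) (ε * ∫ x, v₁ x ∂μ) T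
      (fun s => ∫ x, |u s x| ^ q ∂μ) (fun s => ∫ x, v s x ∂μ) (fun s => ∫ x, vel T v s x ∂μ) := by
  intro a ha haT t ht
  have key := h.eq_v _ (isTestFunction_of_contDiff ha haT) t ht
  simp only [dt, laplaceBeltrami_const, integral_mul_const, sub_zero] at key
  simp only [zero_mul, sub_zero, ne_eq, OfNat.ofNat_ne_zero, not_false_eq_true, zero_pow, add_zero]
  linear_combination key

theorem IsEnergySolution.meanSystem [IsProbabilityMeasure μ]
    (h : IsEnergySolution g μ b m p q ε u₀ u₁ v₀ v₁ T u v) (hb : 0 ≤ b)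
    (hbm : 4 * m ^ 2 ≤ b ^ 2) (hp : 1 ≤ p) (hq : 1 ≤ q) (hε : 0 ≤ ε)
    (hu₀ : 0 ≤ ∫ x, u₀ x ∂μ) (hu₁ : 0 ≤ ∫ x, u₁ x ∂μ) (hv₁ : 0 ≤ ∫ x, v₁ x ∂μ) :
    MeanSystem p q b m (ε * ∫ x, v₀ x ∂μ) (ε * ∫ x, v₁ x ∂μ) T
      (fun s => ∫ x, |u s x| ^ q ∂μ) (fun s => ∫ x, |v s x| ^ p ∂μ)
      (fun s => ∫ x, u s x ∂μ) (fun s => ∫ x, v s x ∂μ) where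
  c₁_nonneg := mul_nonneg hε hv₁
  F_nonneg _ := integral_nonneg fun _ => by positivity
  P_nonneg _ := integral_nonneg fun _ => by positivity
  F_integrable _ ht := h.u_Lq.intervalIntegrable ht
  P_integrable _ ht := h.v_Lp.intervalIntegrable ht
  V_eq t ht := by simpa using h.isWeakOscillator_mean_v.duhamel (by norm_num) ht
  le_U t ht := by
    have hS : 0 ≤ dampedSinh b m t := dampedSinh_nonneg ht.1.le
    have hC : 0 ≤ dampedCosh b m t := dampedCosh_nonneg
    rw [h.isWeakOscillator_mean_u.duhamel hbm ht]
    exact le_add_of_nonneg_left (by positivity)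
  le_F _ ht := h.u_Lq.abs_integral_rpow_le hq ht
  le_P _ ht := h.v_Lp.abs_integral_rpow_le hp ht

theorem exists_forall_le_of_isEnergySolution [IsProbabilityMeasure μ] (g : RiemMetric n M)
    (hb : 0 ≤ b) (hbm : 4 * m ^ 2 ≤ b ^ 2) (hp : 1 ≤ p) (hq : 1 ≤ q) (hpq : 1 < p * q)
    (hu₀ : 0 ≤ ∫ x, u₀ x ∂μ) (hu₁ : 0 ≤ ∫ x, u₁ x ∂μ) (hv₁ : 0 ≤ ∫ x, v₁ x ∂μ) :
    ∃ C₁ C₂ : ℝ, 0 < C₁ ∧ 0 < C₂ ∧ ∀ ⦃ε : ℝ⦄, 0 ≤ ε → ∀ ⦃u v : ℝ → Lp ℝ 2 μ⦄ ⦃T : ℝ⦄,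
      IsEnergySolution g μ b m p q ε u₀ u₁ v₀ v₁ T u v →
      ∀ t A, 0 < t → 0 < A → A ≤ ε * ∫ x, v₀ x ∂μ + ε * (∫ x, v₁ x ∂μ) * t →
        T ≤ t + C₁ + C₂ * A ^ (-((p * q - 1) / 2)) := by
  have hq0 : 0 < q := zero_lt_one.trans_le hq
  obtain ⟨C₁, C₂, hC₁, hC₂, hbound⟩ := exists_forall_le_of_hasDelayedGain
    (c := (Real.exp (-(b / 2)) / 2) ^ q / 2) (by positivity) hpq (mul_pos two_pos hq0) two_pos
  refine ⟨C₁, C₂, hC₁, hC₂, fun ε hε u v T h t A ht hA hAV => ?_⟩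
  have hmean := h.meanSystem hb hbm hp hq hε hu₀ hu₁ hv₁
  exact hbound (hmean.hasDelayedGain hb (zero_le_one.trans hp) hq0.le) hmean.monotoneOn t A ht hA
    fun htT => hAV.trans (hmean.linear_le ⟨ht, htT⟩)

theorem lifespan_le
    (h : ∀ τ, IsEnergySolution g μ b m p q ε u₀ u₁ v₀ v₁ τ u v → τ ≤ B) :
    lifespan g μ b m p q ε u₀ u₁ v₀ v₁ u v ≤ ENNReal.ofReal B :=
  iSup₂_le fun τ hτ => ENNReal.ofReal_le_ofReal (h τ hτ.2)

end Averages

/-! ### Choice of the starting time -/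

section StartingTime

variable {r C₁ C₂ V₀ V₁ ε T : ℝ}

theorem one_le_rpow_neg_div (hε : ε ∈ Ioc 0 1) {a d : ℝ} (ha : 0 < a) (hd : 0 < d) :
    1 ≤ ε ^ (-(a / d)) :=
  Real.one_le_rpow_of_pos_of_le_one_of_nonpos hε.1 hε.2 (neg_nonpos.2 (div_pos ha hd).le)

/-- The linear growth rate `ε * V₁` sets the scale: at a time of order `E = ε ^ (-(r-1)/(r+1))`, the
level `ε * V₁ * E` makes the remaining time to blow-up of order `E` as well. -/
theorem le_mul_rpow_of_slope_pos (hr : 1 < r) (hC₁ : 0 ≤ C₁) (hV₁ : 0 < V₁) (hε : ε ∈ Ioc 0 1)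
    (h : ∀ t A, 0 < t → 0 < A → A ≤ ε * V₀ + ε * V₁ * t →
      T ≤ t + C₁ + C₂ * A ^ (-((r - 1) / 2))) :
    T ≤ (1 + |V₀| / V₁ + C₁ + C₂ * V₁ ^ (-((r - 1) / 2))) * ε ^ (-((r - 1) / (r + 1))) := by
  have hr₁ : 0 < r + 1 := by linarith
  have hε0 : 0 < ε := hε.1
  have hE1 := one_le_rpow_neg_div hε (sub_pos.2 hr) hr₁
  have hexp : 1 + -((r - 1) / (r + 1)) ≠ 0 := by
    rw [show 1 + -((r - 1) / (r + 1)) = 2 / (r + 1) by field_simp; ring]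
    positivity
  have hbalance : (ε * ε ^ (-((r - 1) / (r + 1)))) ^ (-((r - 1) / 2)) =
      ε ^ (-((r - 1) / (r + 1))) := by
    rw [← Real.rpow_one_add' hε0.le hexp, ← Real.rpow_mul hε0.le]
    congr 1
    field_simp
    ring
  set E := ε ^ (-((r - 1) / (r + 1)))
  have hE : 0 < E := zero_lt_one.trans_le hE1
  have hlevel : ε * E * V₁ ≤ ε * V₀ + ε * V₁ * ((1 + |V₀| / V₁) * E) := by
    have hV₀ : 0 ≤ V₀ + |V₀| * E := by nlinarith [neg_abs_le V₀, abs_nonneg V₀]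
    calc ε * E * V₁ ≤ ε * E * V₁ + ε * (V₀ + |V₀| * E) :=
          le_add_of_nonneg_right (mul_nonneg hε0.le hV₀)
      _ = ε * V₀ + ε * V₁ * ((1 + |V₀| / V₁) * E) := by field_simp; ring
  have hT := h ((1 + |V₀| / V₁) * E) (ε * E * V₁) (mul_pos (by positivity) hE)
    (by positivity) hlevel
  rw [Real.mul_rpow (by positivity) hV₁.le, hbalance] at hT
  calc T ≤ (1 + |V₀| / V₁) * E + C₁ + C₂ * (E * V₁ ^ (-((r - 1) / 2))) := hT
    _ ≤ (1 + |V₀| / V₁) * E + C₁ * E + C₂ * (E * V₁ ^ (-((r - 1) / 2))) := by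
        gcongr
        exact le_mul_of_one_le_right hC₁ hE1
    _ = (1 + |V₀| / V₁ + C₁ + C₂ * V₁ ^ (-((r - 1) / 2))) * E := by ring

theorem le_mul_rpow_of_initial_pos (hr : 1 < r) (hC₁ : 0 ≤ C₁) (hV₀ : 0 < V₀) (hV₁ : 0 ≤ V₁)
    (hε : ε ∈ Ioc 0 1)
    (h : ∀ t A, 0 < t → 0 < A → A ≤ ε * V₀ + ε * V₁ * t →
      T ≤ t + C₁ + C₂ * A ^ (-((r - 1) / 2))) :
    T ≤ (1 + C₁ + C₂ * V₀ ^ (-((r - 1) / 2))) * ε ^ (-((r - 1) / 2)) := by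
  have hε0 : 0 < ε := hε.1
  have hE1 := one_le_rpow_neg_div hε (sub_pos.2 hr) two_pos
  have hT := h 1 (ε * V₀) one_pos (by positivity) (le_add_of_nonneg_right (by positivity))
  rw [Real.mul_rpow hε0.le hV₀.le] at hT
  set E := ε ^ (-((r - 1) / 2))
  calc T ≤ 1 + C₁ + C₂ * (E * V₀ ^ (-((r - 1) / 2))) := hT
    _ ≤ (1 + C₁) * E + C₂ * (E * V₀ ^ (-((r - 1) / 2))) := by
        gcongr
        exact le_mul_of_one_le_right (by positivity) hE1
    _ = (1 + C₁ + C₂ * V₀ ^ (-((r - 1) / 2))) * E := by ring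

end StartingTime

end CompactLieWave

theorem theorem2p1_general {n : ℕ} {M : Type*} [TopologicalSpace M]
    [ChartedSpace (EuclideanSpace ℝ (Fin n)) M] [IsManifold (𝓡 n) 1 M]
    (g : CompactLieWave.RiemMetric n M) [MeasurableSpace M] (μ : Measure M)
    [IsProbabilityMeasure μ] (b m p q : ℝ) (hb : 0 ≤ b) (hbm : 4 * m ^ 2 ≤ b ^ 2)
    (hp : 1 ≤ p) (hq : 1 ≤ q) (hpq : 1 < p * q) (u₀ u₁ v₀ v₁ : Lp ℝ 2 μ)
    (hu₀ : 0 ≤ ∫ x, u₀ x ∂μ) (hu₁ : 0 ≤ ∫ x, u₁ x ∂μ) (hv₁ : 0 ≤ ∫ x, v₁ x ∂μ)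
    (hv : 0 < ∫ x, v₀ x ∂μ ∨ 0 < ∫ x, v₁ x ∂μ) :
    ∃ C : ℝ, 0 < C ∧ ∀ ε ∈ Ioc (0 : ℝ) 1, ∀ u v : ℝ → Lp ℝ 2 μ,
      CompactLieWave.lifespan g μ b m p q ε u₀ u₁ v₀ v₁ u v < ⊤ ∧
      (0 < ∫ x, v₁ x ∂μ → CompactLieWave.lifespan g μ b m p q ε u₀ u₁ v₀ v₁ u v ≤
        ENNReal.ofReal (C * ε ^ (-((p * q - 1) / (p * q + 1))))) ∧
      (0 < ∫ x, v₀ x ∂μ → CompactLieWave.lifespan g μ b m p q ε u₀ u₁ v₀ v₁ u v ≤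
        ENNReal.ofReal (C * ε ^ (-((p * q - 1) / 2)))) := by
  obtain ⟨C₁, C₂, hC₁, hC₂, hT⟩ :=
    CompactLieWave.exists_forall_le_of_isEnergySolution g hb hbm hp hq hpq hu₀ hu₁ hv₁
  set V₀ := ∫ x, v₀ x ∂μ
  set V₁ := ∫ x, v₁ x ∂μ
  set K₁ := 1 + |V₀| / V₁ + C₁ + C₂ * V₁ ^ (-((p * q - 1) / 2))
  set K₀ := 1 + C₁ + C₂ * V₀ ^ (-((p * q - 1) / 2))
  refine ⟨max K₁ K₀, lt_max_of_lt_left (by positivity), fun ε hε u v => ?_⟩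
  have slope (h₁ : 0 < V₁) : CompactLieWave.lifespan g μ b m p q ε u₀ u₁ v₀ v₁ u v ≤
      ENNReal.ofReal (max K₁ K₀ * ε ^ (-((p * q - 1) / (p * q + 1)))) :=
    CompactLieWave.lifespan_le fun τ h =>
      (CompactLieWave.le_mul_rpow_of_slope_pos hpq hC₁.le h₁ hε (hT hε.1.le h)).trans
        (mul_le_mul_of_nonneg_right (le_max_left _ _) (Real.rpow_nonneg hε.1.le _))
  have initial (h₀ : 0 < V₀) : CompactLieWave.lifespan g μ b m p q ε u₀ u₁ v₀ v₁ u v ≤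
      ENNReal.ofReal (max K₁ K₀ * ε ^ (-((p * q - 1) / 2))) :=
    CompactLieWave.lifespan_le fun τ h =>
      (CompactLieWave.le_mul_rpow_of_initial_pos hpq hC₁.le h₀ hv₁ hε (hT hε.1.le h)).trans
        (mul_le_mul_of_nonneg_right (le_max_right _ _) (Real.rpow_nonneg hε.1.le _))
  exact ⟨hv.elim (fun h₀ => (initial h₀).trans_lt ENNReal.ofReal_lt_top)
    fun h₁ => (slope h₁).trans_lt ENNReal.ofReal_lt_top, slope, initial⟩

theorem theorem2p1 {n : ℕ} {G : Type*} [TopologicalSpace G] [T2Space G] [CompactSpace G]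
    [ChartedSpace (EuclideanSpace ℝ (Fin n)) G] [Group G] [LieGroup (𝓡 n) ∞ G]
    (g : CompactLieWave.RiemMetric n G) (hg : CompactLieWave.IsBiInvariant g)
    [MeasurableSpace G] [BorelSpace G]
    (μ : Measure G) [μ.IsHaarMeasure] [IsProbabilityMeasure μ]
    (b m p q : ℝ) (hb : 0 < b) (hm : 0 < m ^ 2) (hbm : 4 * m ^ 2 ≤ b ^ 2)
    (hp : 1 < p) (hq : 1 < q)
    (u₀ u₁ v₀ v₁ : Lp ℝ 2 μ)
    (hu₀H : CompactLieWave.MemH1 g μ u₀) (hv₀H : CompactLieWave.MemH1 g μ v₀)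
    (hu₀ : 0 ≤ u₀) (hu₁ : 0 ≤ u₁) (hv₀ : 0 ≤ v₀) (hv₁ : 0 ≤ v₁)
    (hu : u₀ ≠ 0 ∨ u₁ ≠ 0) (hv : v₀ ≠ 0 ∨ v₁ ≠ 0) :
    ∃ ε₀ C : ℝ, 0 < ε₀ ∧ 0 < C ∧
      ∀ ε : ℝ, 0 < ε → ε ≤ ε₀ →
        ∀ u v : ℝ → Lp ℝ 2 μ,
          (∃ T : ℝ, 0 < T ∧
            CompactLieWave.IsEnergySolution g μ b m p q ε u₀ u₁ v₀ v₁ T u v) →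
          CompactLieWave.lifespan g μ b m p q ε u₀ u₁ v₀ v₁ u v < ⊤ ∧
          (v₁ ≠ 0 → CompactLieWave.lifespan g μ b m p q ε u₀ u₁ v₀ v₁ u v ≤
            ENNReal.ofReal (C * ε ^ (-((p * q - 1) / (p * q + 1))))) ∧
          (v₁ = 0 → CompactLieWave.lifespan g μ b m p q ε u₀ u₁ v₀ v₁ u v ≤
            ENNReal.ofReal (C * ε ^ (-((p * q - 1) / 2)))) := by
  have pos {f : Lp ℝ 2 μ} (hf : 0 ≤ f) (hf0 : f ≠ 0) : 0 < ∫ x, f x ∂μ :=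
    CompactLieWave.integral_Lp_pos one_le_two hf hf0
  obtain ⟨C, hC, h⟩ := theorem2p1_general g μ b m p q hb.le hbm hp.le hq.le
    (one_lt_mul_of_lt_of_le hp hq.le) u₀ u₁ v₀ v₁ (CompactLieWave.integral_Lp_nonneg hu₀)
    (CompactLieWave.integral_Lp_nonneg hu₁) (CompactLieWave.integral_Lp_nonneg hv₁)
    (hv.imp (pos hv₀) (pos hv₁))
  refine ⟨1, C, one_pos, hC, fun ε hε hε1 u v _ => ?_⟩
  obtain ⟨hfin, hslope, hinitial⟩ := h ε ⟨hε, hε1⟩ u v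
  exact ⟨hfin, fun h₁ => hslope (pos hv₁ h₁),
    fun h₁ => hinitial (pos hv₀ (hv.resolve_right (not_not.2 h₁)))⟩
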